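/- Theorem 1.1. A strict partition $\lambda=(\lambda_1>\lambda_2>\cdots>\lambda_\ell>0)$ is a strictly decreasing finite (possibly empty) sequence of positive integers; $\ell(\lambda)=\ell$ is its length and $|\lambda|=\sum_i\lambda_i$ its size. Its shifted Young diagram is $S(\lambda)=\{(i,j)\in\mathbb Z^2 : 1\le i\le \ell(\lambda),\ i\le j\le \lambda_i+i-1\}$. Let $\mathcal{SP}_n$ be the set of strict partitions of size $n$, and let $g^\lambda$ be the number of sequences $\emptyset=\lambda^{(0)},\lambda^{(1)},\dots,\lambda^{(|\lambda|)}=\lambda$ of strict partitions such that each $S(\lambda^{(i)})$ is obtained from $S(\lambda^{(i-1)})$ by adding exactly one box. Let $\Gamma$ be the algebra of supersymmetric functions, i.e. the subalgebra of the algebra of symmetric functions over $\mathbb Q$ generated by the odd power sums $p_{2m+1}(x_1,x_2,\dots)=x_1^{2m+1}+x_2^{2m+1}+\cdots$, $m=0,1,2,\dots$, and for $f\in\Gamma$ write $f(\lambda_1,\dots,\lambda_{\ell(\lambda)})=f(\lambda_1,\dots,\lambda_{\ell(\lambda)},0,0,\dots)$. Then for every $f\in\Gamma$ the shifted Plancherel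 average $$\mathbb E_n[f]=\sum_{\lambda\in\mathcal{SP}_n}\frac{2^{\,n-\ell(\lambda)}(g^\lambda)^2}{n!}\,f(\lambda_1,\dots,\lambda_{\ell(\lambda)})$$ is a polynomial function of $n$: there is a polynomial $P\in\mathbb Q[x]$ such that $\mathbb E_n[f]=P(n)$ for all integers $n\ge 0$. -/

import Mathlib

/-- A strict partition `lam = (lam₁ > lam₂ > ⋯ > lam_l > 0)`: a strictly decreasing finite
sequence of positive integers (the empty sequence is allowed). -/
@[ext]
structure StrictPartition where
  parts : List ℕ
  decreasing : parts.Pairwise (· > ·)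
  pos : ∀ a ∈ parts, 0 < a

namespace StrictPartition

/-- The empty partition. -/
def empty : StrictPartition := ⟨[], List.Pairwise.nil, by simp⟩

/-- The length `ℓ(lam)`, the number of parts. -/
def length (lam : StrictPartition) : ℕ := lam.parts.length

/-- The size `|lam|`, the sum of the parts. -/
def size (lam : StrictPartition) : ℕ := lam.parts.sum

/-- The part `lam_i`, numbered from `i = 1`; it is only used for `1 ≤ i ≤ ℓ(lam)`. -/
def part (lam : StrictPartition) (i : ℕ) : ℕ := lam.parts.getD (i - 1) 0

/-- The shifted Young diagram
`S(lam) = {(i, j) : 1 ≤ i ≤ ℓ(lam), i ≤ j ≤ lam_i + i - 1}`. -/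
def diagram (lam : StrictPartition) : Set (ℕ × ℕ) :=
  {b | 1 ≤ b.1 ∧ b.1 ≤ lam.length ∧ b.1 ≤ b.2 ∧ b.2 < lam.part b.1 + b.1}

/-- A standard tableau of shape `S(lam/mu)`: a sequence `(T 0, …, T k)` of strict partitions,
`k = |lam| - |mu|`, with `T 0 = mu`, `T k = lam`, where each diagram `S(T (i+1))` is obtained
from `S(T i)` by adding exactly one box. (There is none unless `S(mu) ⊆ S(lam)`.) -/
def IsStandardTableau (lam mu : StrictPartition)
    (T : Fin (lam.size - mu.size + 1) → StrictPartition) : Prop :=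
  T 0 = mu ∧ T (Fin.last _) = lam ∧
    ∀ i : Fin (lam.size - mu.size),
      ∃ b, b ∉ (T i.castSucc).diagram ∧ (T i.succ).diagram = insert b (T i.castSucc).diagram

/-- `g^{lam/mu}`, the number of standard tableaux of shape `S(lam/mu)`. -/
noncomputable def numSkewTableaux (lam mu : StrictPartition) : ℕ :=
  Nat.card {T : Fin (lam.size - mu.size + 1) → StrictPartition // IsStandardTableau lam mu T}

/-- `g^lam = g^{lam/∅}`. -/
noncomputable def numTableaux (lam : StrictPartition) : ℕ := numSkewTableaux lam empty

theorem finite_size_eq (n : ℕ) : {lam : StrictPartition | lam.size = n}.Finite := by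
  have hinj : Set.InjOn (fun lam : StrictPartition => lam.parts.toFinset)
      {lam : StrictPartition | lam.size = n} := by
    intro a _ b _ h
    apply StrictPartition.ext
    have hn : ∀ c : StrictPartition, c.parts.Nodup := fun c =>
      c.decreasing.imp (fun h => Nat.ne_of_gt h)
    exact List.Perm.eq_of_pairwise (fun x y _ _ hxy hyx => absurd hxy (Nat.lt_asymm hyx))
      a.decreasing b.decreasing
      (List.perm_of_nodup_nodup_toFinset_eq (hn a) (hn b) h)
  refine Set.Finite.of_finite_image ((Finset.finite_toSet (Finset.range (n + 1)).powerset).subset ?_)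
    hinj
  rintro _ ⟨a, ha, rfl⟩
  simp only [Finset.coe_powerset, Set.mem_preimage, Set.mem_powerset_iff]
  intro x hx
  have hx' : x ∈ a.parts := by simpa using hx
  have h1 : x ≤ a.parts.sum := List.le_sum_of_mem hx'
  have h2 : a.parts.sum = n := ha
  simp only [Finset.coe_range, Set.mem_Iio]
  omega

/-- `SP n`, the finite set of strict partitions of `n`. -/
noncomputable def SP (n : ℕ) : Finset StrictPartition := (finite_size_eq n).toFinset

/-- The shifted Plancherel measure `ℙ_n(lam) = 2^{n-ℓ(lam)} (g^lam)² / n!` on `SP n`. -/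
noncomputable def shiftedPlancherel (n : ℕ) (lam : StrictPartition) : ℚ :=
  (2 : ℚ) ^ ((n : ℤ) - (lam.length : ℤ)) * (lam.numTableaux : ℚ) ^ 2 / (n.factorial : ℚ)

/-- The shifted Plancherel average `𝔼_n[φ]` of a function `φ` on strict partitions. -/
noncomputable def shiftedPlancherelAverage (n : ℕ) (φ : StrictPartition → ℚ) : ℚ :=
  ∑ lam ∈ SP n, shiftedPlancherel n lam * φ lam

end StrictPartition

/-- The substitution `F(x₁, …, x_N, x_{N+1}) ↦ F(x₁, …, x_N, 0)`. -/
noncomputable def setLastZero (N : ℕ) :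
    MvPolynomial (Fin (N + 1)) ℚ →ₐ[ℚ] MvPolynomial (Fin N) ℚ :=
  MvPolynomial.aeval (Fin.snoc (α := fun _ => MvPolynomial (Fin N) ℚ) MvPolynomial.X 0)

/-- The algebra of symmetric functions over `ℚ`: families `(F_N)` of symmetric polynomials in
`N` variables with `F_{N+1}(x₁, …, x_N, 0) = F_N(x₁, …, x_N)`. (The index `N = 0` is included;
`F_0` is the constant term.) -/
noncomputable def SymmetricFunctions : Subalgebra ℚ ((N : ℕ) → MvPolynomial (Fin N) ℚ) where
  carrier := {F | (∀ N, (F N).IsSymmetric) ∧ ∀ N, setLastZero N (F (N + 1)) = F N}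
  mul_mem' := by
    rintro F G ⟨hF, hF'⟩ ⟨hG, hG'⟩
    exact ⟨fun N => (hF N).mul (hG N), fun N => by simp [hF', hG']⟩
  add_mem' := by
    rintro F G ⟨hF, hF'⟩ ⟨hG, hG'⟩
    exact ⟨fun N => (hF N).add (hG N), fun N => by simp [hF', hG']⟩
  algebraMap_mem' := by
    intro r
    exact ⟨fun N => MvPolynomial.IsSymmetric.C r, fun N => (setLastZero N).commutes r⟩

theorem psum_mem_SymmetricFunctions {r : ℕ} (hr : 0 < r) :
    (fun N => MvPolynomial.psum (Fin N) ℚ r) ∈ SymmetricFunctions := by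
  refine ⟨fun N => MvPolynomial.psum_isSymmetric (Fin N) ℚ r, fun N => ?_⟩
  simp [setLastZero, MvPolynomial.psum, Fin.sum_univ_castSucc, hr.ne']

/-- The odd power-sum symmetric function `p_{2m+1}(x₁, x₂, …) = x₁^{2m+1} + x₂^{2m+1} + ⋯`. -/
noncomputable def oddPowerSum (m : ℕ) : SymmetricFunctions :=
  ⟨fun N => MvPolynomial.psum (Fin N) ℚ (2 * m + 1),
    psum_mem_SymmetricFunctions (Nat.succ_pos _)⟩

/-- The algebra `Γ` of supersymmetric functions: the subalgebra of the symmetric functions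
generated by `p_1, p_3, p_5, …`. -/
noncomputable def SupersymmetricFunctions : Subalgebra ℚ SymmetricFunctions :=
  Algebra.adjoin ℚ (Set.range oddPowerSum)

/-- The value `f(lam) = f(lam₁, …, lam_l)` with `l = ℓ(lam)`, all other variables being `0`. -/
noncomputable def symmetricValue (f : SymmetricFunctions) (lam : StrictPartition) : ℚ :=
  MvPolynomial.eval (fun i : Fin lam.length => (lam.part (i + 1) : ℚ)) (f.1 lam.length)

/-!
Identify a strict partition `lam` of `n` with its set of parts `S`. Adding a box replaces some
`x ∈ S ∪ {0}` with `x + 1 ∉ S` by `x + 1`. A partial fraction identity shows that the product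
formula `g^lam = n! / ∏ x! * ∏_{x > y} (x - y) / (x + y)` satisfies the recursion
`g^mu = ∑ g^lam` over all `lam` obtained from `mu` by removing a box
(`numTableaux_eq_productFormula`). Together with this recursion, the definition of the shifted
Plancherel measures gives `𝔼_{n+1}[F] = 𝔼_n[∑ₓ pₓ F(lam + box)]` (`average_succ`), where the
weights `pₓ`, explicit products by the product formula, are the coefficients in the partial
fraction decomposition
`∑ₓ pₓ / (u - x (x + 1)) = u⁻¹ ∏_{y ∈ S} (u - y (y - 1)) / (u - y (y + 1))`.
Hence the moments `∑ₓ pₓ (x (x + 1))^k` are the coefficients of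
`∏ (1 - y (y - 1) X) / (1 - y (y + 1) X)`, and by Newton's identities they are polynomials in the
sums `∑_y ((y (y + 1))^r - (y (y - 1))^r)`, which are linear combinations of the odd power sums
`p_1, p_3, …, p_{2r-1}`.

Give `p_{2m+1}` the degree `m + 1`. Since `(x + 1)^{2m+1} - x^{2m+1}` is a polynomial of degree `m`
in `z = x (x + 1)`, adding a box changes a function of degree at most `d` in `Γ` by a polynomial in
`z` with coefficients in `Γ`, of total degree less than `d`
(`SuperDegLE.exists_increment`). As the `k`-th moment has degree at most `k`, averaging over the
transition probabilities leaves a function of degree less than `d`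
(`IncrDegLT.exists_average`). So `𝔼_{n+1}[f] - 𝔼_n[f] = 𝔼_n[g]` with `g` of smaller degree, and
induction on the degree finishes the proof (`SuperDegLE.exists_polynomial`).
-/

/-! ### Strict partitions as sets of parts -/

namespace StrictPartition

/-- The set of parts of a strict partition; it determines the partition. -/
def partSet (lam : StrictPartition) : Finset ℕ := lam.parts.toFinset

theorem nodup_parts (lam : StrictPartition) : lam.parts.Nodup :=
  lam.decreasing.imp fun h => Nat.ne_of_gt h

theorem partSet_injective : Function.Injective partSet := by
  intro a b h
  apply StrictPartition.ext
  exact List.Perm.eq_of_pairwise (fun x y _ _ hxy hyx => absurd hxy (Nat.lt_asymm hyx))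
    a.decreasing b.decreasing
    (List.perm_of_nodup_nodup_toFinset_eq a.nodup_parts b.nodup_parts h)

theorem zero_notMem_partSet (lam : StrictPartition) : 0 ∉ lam.partSet := by
  intro h
  exact (lam.pos 0 (by simpa [partSet] using h)).false

/-- The strict partition with a prescribed set of parts. -/
def ofPartSet (S : Finset ℕ) (h : 0 ∉ S) : StrictPartition where
  parts := S.sort (· ≥ ·)
  decreasing := S.sortedGT_sort.pairwise
  pos a ha := Nat.pos_of_ne_zero fun h0 => h (by simpa [h0] using ha)

@[simp]
theorem partSet_ofPartSet (S : Finset ℕ) (h : 0 ∉ S) : (ofPartSet S h).partSet = S := by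
  simp [partSet, ofPartSet]

theorem size_eq_sum (lam : StrictPartition) : lam.size = ∑ x ∈ lam.partSet, x := by
  have := List.sum_toFinset (fun x : ℕ => x) lam.nodup_parts
  simpa [size, partSet] using this.symm

theorem length_eq_card (lam : StrictPartition) : lam.length = lam.partSet.card :=
  (List.toFinset_card_of_nodup lam.nodup_parts).symm

theorem mem_SP {n : ℕ} {lam : StrictPartition} : lam ∈ SP n ↔ ∑ x ∈ lam.partSet, x = n := by
  simp [SP, size_eq_sum]

/-! ### Adding a box, in terms of the set of parts -/

/-- `S(mu)` is obtained from `S(lam)` by adding exactly one box. -/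
def AddBox (lam mu : StrictPartition) : Prop :=
  ∃ b, b ∉ lam.diagram ∧ mu.diagram = insert b lam.diagram

/-- The number of elements of `S` exceeding `k`; for a set of parts, this is the length of the
`k`-th diagonal of the shifted diagram. -/
def countGT (S : Finset ℕ) (k : ℕ) : ℕ := (S.filter (k < ·)).card

theorem countGT_insert {a : ℕ} {T : Finset ℕ} (h : a ∉ T) (k : ℕ) :
    countGT (insert a T) k = countGT T k + if k < a then 1 else 0 := by
  unfold countGT
  rw [Finset.filter_insert]
  split_ifs with hk
  · rw [Finset.card_insert_of_notMem (by simp [h])]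
  · rfl

theorem countGT_eq_succ (S : Finset ℕ) (k : ℕ) :
    countGT S k = countGT S (k + 1) + if k + 1 ∈ S then 1 else 0 := by
  unfold countGT
  have h : S.filter (k < ·) = S.filter (k + 1 < ·) ∪ S.filter (k + 1 = ·) := by
    ext s; simp only [Finset.mem_filter, Finset.mem_union]; grind
  rw [h, Finset.card_union_of_disjoint, Finset.filter_eq]
  · split_ifs <;> simp
  · rw [Finset.disjoint_filter]; intros; omega

theorem lt_getD_iff {L : List ℕ} (hL : L.Pairwise (· > ·)) (i k : ℕ) :
    k < L.getD i 0 ↔ i < (L.filter (k < ·)).length := by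
  induction L generalizing i with
  | nil => simp
  | cons a t ih =>
    rw [List.pairwise_cons] at hL
    by_cases hk : k < a
    · cases i with
      | zero => simp [hk]
      | succ i => simpa [hk] using ih hL.2 i
    · have ht : t.filter (k < ·) = [] := by
        rw [List.filter_eq_nil_iff]
        intro b hb
        have := hL.1 b hb
        simp; omega
      cases i with
      | zero => simpa [hk] using ht
      | succ i =>
        have := ih hL.2 i
        rw [ht] at this
        simpa [hk, ht] using this

theorem lt_part_iff (lam : StrictPartition) {i : ℕ} (hi : 1 ≤ i) (k : ℕ) :
    k < lam.part i ↔ i ≤ countGT lam.partSet k := by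
  have h : countGT lam.partSet k = (lam.parts.filter (k < ·)).length := by
    rw [countGT, partSet, ← List.toFinset_card_of_nodup (lam.nodup_parts.filter _),
      List.toFinset_filter]
    simp
  rw [part, lt_getD_iff lam.decreasing, h]
  omega

theorem mem_diagram (lam : StrictPartition) (i k : ℕ) :
    (i, i + k) ∈ lam.diagram ↔ 1 ≤ i ∧ i ≤ countGT lam.partSet k := by
  simp only [diagram, Set.mem_ofPred_eq]
  constructor
  · rintro ⟨h1, -, -, h⟩
    exact ⟨h1, (lam.lt_part_iff h1 k).1 (by omega)⟩
  · rintro ⟨h1, h⟩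
    have h2 := (lam.lt_part_iff h1 k).2 h
    refine ⟨h1, ?_, by omega, by omega⟩
    by_contra hlen
    have : lam.part i = 0 := by
      rw [part, List.getD_eq_default]
      simp only [length] at hlen
      omega
    omega

theorem le_of_mem_diagram {lam : StrictPartition} {b : ℕ × ℕ} (h : b ∈ lam.diagram) :
    1 ≤ b.1 ∧ b.1 ≤ b.2 := ⟨h.1, h.2.2.1⟩

/-- Adding a box lengthens exactly one diagonal of the diagram, and that by one. -/
theorem addBox_iff_countGT {lam mu : StrictPartition} :
    AddBox lam mu ↔ ∃ x, ∀ k,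
      countGT mu.partSet k = countGT lam.partSet k + if k = x then 1 else 0 := by
  constructor
  · rintro ⟨⟨r, c⟩, hb, h⟩
    have hrc : (r, c) ∈ mu.diagram := by rw [h]; exact Set.mem_insert _ _
    have hle := le_of_mem_diagram hrc
    obtain ⟨x, rfl⟩ : ∃ x, c = r + x := Nat.exists_eq_add_of_le hle.2
    rw [mem_diagram] at hb hrc
    refine ⟨x, fun k => ?_⟩
    have key : ∀ i, (1 ≤ i ∧ i ≤ countGT mu.partSet k) ↔
        ((i = r ∧ k = x) ∨ (1 ≤ i ∧ i ≤ countGT lam.partSet k)) := by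
      intro i
      rw [← mem_diagram, ← mem_diagram, h, Set.mem_insert_iff, Prod.mk.injEq]
      constructor <;> (rintro (h | h); · left; omega
                       · right; exact h)
    have k1 := key (countGT mu.partSet k)
    have k2 := key (countGT lam.partSet k)
    have k3 := key (countGT lam.partSet k + 1)
    have k4 := key (countGT lam.partSet k + 2)
    split_ifs with hk
    · subst hk; omega
    · omega
  · rintro ⟨x, h⟩
    refine ⟨(countGT lam.partSet x + 1, countGT lam.partSet x + 1 + x), ?_, ?_⟩
    · rw [mem_diagram]; omega
    · ext ⟨i, j⟩
      by_cases hij : i ≤ j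
      · obtain ⟨k, rfl⟩ := Nat.exists_eq_add_of_le hij
        rw [Set.mem_insert_iff, mem_diagram, mem_diagram, h k, Prod.mk.injEq]
        split_ifs with hk
        · subst hk; omega
        · omega
      · refine ⟨fun hm => absurd (le_of_mem_diagram hm).2 hij, fun hm => ?_⟩
        rw [Set.mem_insert_iff, Prod.mk.injEq] at hm
        rcases hm with hm | hm
        · omega
        · exact absurd (le_of_mem_diagram hm).2 hij

/-- Adding a box replaces a part `x` by `x + 1`, where the new part `1` is regarded as
coming from a part `x = 0`. The set `T` consists of the parts that do not change. -/
theorem addBox_iff {lam mu : StrictPartition} :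
    AddBox lam mu ↔ ∃ x T, 0 ∉ T ∧ x ∉ T ∧ x + 1 ∉ T ∧
      lam.partSet = (insert x T).erase 0 ∧ mu.partSet = insert (x + 1) T := by
  have h0l := lam.zero_notMem_partSet
  have h0m := mu.zero_notMem_partSet
  rw [addBox_iff_countGT]
  constructor
  · rintro ⟨x, h⟩
    have hmem : ∀ k, (if k + 1 ∈ mu.partSet then 1 else 0) + (if k + 1 = x then 1 else 0) =
        (if k + 1 ∈ lam.partSet then 1 else 0) + (if k = x then 1 else 0) := by
      intro k
      have h1 := countGT_eq_succ mu.partSet k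
      have h2 := countGT_eq_succ lam.partSet k
      have h3 := h k
      have h4 := h (k + 1)
      omega
    have hx := hmem x
    have hx' : x ≠ 0 → x ∈ lam.partSet := by
      intro hx0
      obtain ⟨k, rfl⟩ := Nat.exists_eq_succ_of_ne_zero hx0
      have := hmem k
      by_contra hc
      simp [hc] at this
    have hxm : x + 1 ∈ mu.partSet ∧ x + 1 ∉ lam.partSet := by
      by_cases h1 : x + 1 ∈ mu.partSet <;> by_cases h2 : x + 1 ∈ lam.partSet <;> simp_all
    refine ⟨x, lam.partSet.erase x, by simp [h0l], by simp, by simp [hxm.2], ?_, ?_⟩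
    · by_cases hx0 : x = 0
      · subst hx0; simp [Finset.erase_eq_of_notMem h0l]
      · rw [Finset.insert_erase (hx' hx0), Finset.erase_eq_of_notMem h0l]
    · ext s
      rcases s with _ | k
      · simp [h0l, h0m]
      · have hk := hmem k
        rw [Finset.mem_insert, Finset.mem_erase]
        by_cases h1 : k = x
        · subst h1; simp [hxm.1]
        · by_cases h2 : k + 1 = x
          · subst h2
            simp only [h1, if_false, if_true] at hk
            split_ifs at hk <;> simp_all
          · simp only [h1, h2, if_false] at hk
            split_ifs at hk <;> simp_all
  · rintro ⟨x, T, h0, hx, hx1, hl, hm⟩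
    refine ⟨x, fun k => ?_⟩
    have : countGT lam.partSet k = countGT T k + if k < x then 1 else 0 := by
      rw [hl]
      rcases Nat.eq_zero_or_pos x with rfl | hpos
      · rw [Finset.erase_insert h0]; simp
      · rw [Finset.erase_eq_of_notMem (by simp [h0, hpos.ne]), countGT_insert hx]
    rw [this, hm, countGT_insert hx1]
    split_ifs <;> omega

theorem AddBox.sum_eq {lam mu : StrictPartition} (h : AddBox lam mu) :
    ∑ x ∈ mu.partSet, x = ∑ x ∈ lam.partSet, x + 1 := by
  obtain ⟨x, T, h0, hx, hx1, hl, hm⟩ := addBox_iff.1 h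
  rw [hl, hm, Finset.sum_erase (a := 0) _ rfl, Finset.sum_insert hx, Finset.sum_insert hx1]
  omega

open scoped Classical in
theorem sum_addBox_left (lam : StrictPartition) {n : ℕ} (hn : lam ∈ SP n) (F : Finset ℕ → ℚ) :
    ∑ mu ∈ SP (n + 1) with AddBox lam mu, F mu.partSet =
      ∑ x ∈ insert 0 lam.partSet with x + 1 ∉ lam.partSet,
        F (insert (x + 1) (lam.partSet.erase x)) := by
  have h0 := lam.zero_notMem_partSet
  symm
  refine Finset.sum_bij
    (fun x _ => ofPartSet (insert (x + 1) (lam.partSet.erase x)) (by simp [h0])) ?_ ?_ ?_ ?_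
  · intro x hx
    rw [Finset.mem_filter, Finset.mem_insert] at hx
    have hadd : AddBox lam (ofPartSet (insert (x + 1) (lam.partSet.erase x)) (by simp [h0])) := by
      rw [addBox_iff]
      refine ⟨x, lam.partSet.erase x, by simp [h0], by simp, by simp [hx.2], ?_, by simp⟩
      rcases hx.1 with rfl | hx'
      · simp [Finset.erase_eq_of_notMem h0]
      · rw [Finset.insert_erase hx', Finset.erase_eq_of_notMem h0]
    rw [Finset.mem_filter, mem_SP, hadd.sum_eq, mem_SP.1 hn]
    exact ⟨rfl, hadd⟩
  · intro x hx y hy h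
    rw [Finset.mem_filter] at hx hy
    have h' := congrArg partSet h
    rw [partSet_ofPartSet, partSet_ofPartSet] at h'
    have h1 : x + 1 ∈ insert (y + 1) (lam.partSet.erase y) := h' ▸ Finset.mem_insert_self _ _
    rw [Finset.mem_insert, Finset.mem_erase] at h1
    rcases h1 with h1 | h1
    · omega
    · exact absurd h1.2 hx.2
  · intro mu hmu
    rw [Finset.mem_filter] at hmu
    obtain ⟨x, T, hT0, hx, hx1, hl, hm⟩ := addBox_iff.1 hmu.2
    refine ⟨x, ?_, ?_⟩
    · rw [Finset.mem_filter, hl]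
      simp [hx1, em]
    · apply partSet_injective
      rw [partSet_ofPartSet, hm, hl, Finset.erase_right_comm, Finset.erase_insert hx,
        Finset.erase_eq_of_notMem hT0]
  · intro x hx
    rw [partSet_ofPartSet]

open scoped Classical in
theorem sum_addBox_right (mu : StrictPartition) {n : ℕ} (hn : mu ∈ SP (n + 1))
    (F : Finset ℕ → ℚ) :
    ∑ lam ∈ SP n with AddBox lam mu, F lam.partSet =
      ∑ a ∈ mu.partSet with a - 1 ∉ mu.partSet,
        F ((insert (a - 1) (mu.partSet.erase a)).erase 0) := by
  have h0 := mu.zero_notMem_partSet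
  symm
  refine Finset.sum_bij
    (fun a _ => ofPartSet ((insert (a - 1) (mu.partSet.erase a)).erase 0) (by simp)) ?_ ?_ ?_ ?_
  · intro a ha
    rw [Finset.mem_filter] at ha
    have ha0 : a ≠ 0 := fun h => h0 (h ▸ ha.1)
    have hadd :
        AddBox (ofPartSet ((insert (a - 1) (mu.partSet.erase a)).erase 0) (by simp)) mu := by
      rw [addBox_iff]
      refine ⟨a - 1, mu.partSet.erase a, by simp [h0], by simp [ha.2], ?_, by simp, ?_⟩
      · rw [Nat.sub_add_cancel (Nat.pos_of_ne_zero ha0)]; simp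
      · rw [Nat.sub_add_cancel (Nat.pos_of_ne_zero ha0), Finset.insert_erase ha.1]
    have := hadd.sum_eq
    rw [mem_SP.1 hn] at this
    rw [Finset.mem_filter, mem_SP]
    exact ⟨by omega, hadd⟩
  · intro a ha b hb h
    rw [Finset.mem_filter] at ha hb
    have h' := congrArg partSet h
    rw [partSet_ofPartSet, partSet_ofPartSet] at h'
    by_contra hab
    have h1 : a ∈ (insert (b - 1) (mu.partSet.erase b)).erase 0 := by
      have ha0 : a ≠ 0 := fun h => h0 (h ▸ ha.1)
      simp [ha0, hab, ha.1]
    rw [← h'] at h1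
    simp only [Finset.mem_erase, Finset.mem_insert, ne_eq, not_true, false_and, or_false] at h1
    omega
  · intro lam hlam
    rw [Finset.mem_filter] at hlam
    obtain ⟨x, T, hT0, hx, hx1, hl, hm⟩ := addBox_iff.1 hlam.2
    refine ⟨x + 1, ?_, ?_⟩
    · rw [Finset.mem_filter, hm]
      simp [hx]
    · apply partSet_injective
      rw [partSet_ofPartSet, hm, hl, Finset.erase_insert hx1, Nat.add_sub_cancel]
  · intro x hx
    rw [partSet_ofPartSet]

/-! ### The recursion for the number of standard tableaux -/

/-- Sequences `∅ = T 0, …, T n = lam` of strict partitions in which each term is obtained from the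
previous one by adding a box. -/
abbrev Growth (n : ℕ) (lam : StrictPartition) : Type :=
  {T : Fin (n + 1) → StrictPartition // T 0 = empty ∧ T (Fin.last n) = lam ∧
    ∀ i : Fin n, AddBox (T i.castSucc) (T i.succ)}

theorem sigma_growth_ext {n : ℕ} {mu : StrictPartition}
    {p q : Σ lam : {lam // AddBox lam mu}, Growth n lam} (h : p.2.1 = q.2.1) : p = q := by
  obtain ⟨⟨_, hp⟩, T, h0, h1, hs⟩ := p
  obtain ⟨⟨_, hq⟩, T', h0', h1', hs'⟩ := q
  dsimp only at h h1 h1'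
  subst h1 h1' h
  rfl

/-- Removing the last term of a growth sequence. -/
def growthSuccEquiv (n : ℕ) (mu : StrictPartition) :
    Growth (n + 1) mu ≃ Σ lam : {lam // AddBox lam mu}, Growth n lam where
  toFun T := ⟨⟨T.1 (Fin.last n).castSucc, by
      have h := T.2.2.2 (Fin.last n)
      rw [Fin.succ_last, T.2.2.1] at h
      exact h⟩, ⟨fun i => T.1 i.castSucc, T.2.1, rfl, fun i => T.2.2.2 i.castSucc⟩⟩
  invFun p := ⟨Fin.snoc (α := fun _ => StrictPartition) p.2.1 mu, by
      refine ⟨?_, Fin.snoc_last _ _, fun i => ?_⟩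
      · rw [← Fin.castSucc_zero (n := n + 1), Fin.snoc_castSucc]
        exact p.2.2.1
      · induction i using Fin.lastCases with
        | last =>
          rw [Fin.snoc_castSucc, Fin.succ_last, Fin.snoc_last, p.2.2.2.1]
          exact p.1.2
        | cast i =>
          rw [Fin.snoc_castSucc, Fin.succ_castSucc, Fin.snoc_castSucc]
          exact p.2.2.2.2 i⟩
  left_inv T := by
    refine Subtype.ext (Eq.trans ?_ (Fin.snoc_init_self T.1))
    exact congrArg (Fin.snoc (α := fun _ => StrictPartition) (Fin.init T.1)) T.2.2.1.symm
  right_inv p := by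
    refine sigma_growth_ext (funext fun i => ?_)
    exact Fin.snoc_castSucc (α := fun _ => StrictPartition) mu p.2.1 i

theorem card_growth_zero {lam : StrictPartition} (h : lam ∈ SP 0) :
    Nat.card (Growth 0 lam) = 1 := by
  have hl : lam = empty := by
    apply partSet_injective
    rw [mem_SP, Finset.sum_eq_zero_iff] at h
    have : lam.partSet = ∅ :=
      Finset.eq_empty_of_forall_notMem fun x hx => lam.zero_notMem_partSet (h x hx ▸ hx)
    rw [this]; rfl
  subst hl
  rw [Nat.card_eq_one_iff_unique]
  refine ⟨⟨fun a b => Subtype.ext (funext fun i => ?_)⟩, ⟨fun _ => empty, rfl, rfl, nofun⟩⟩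
  rw [Fin.fin_one_eq_zero i, a.2.1, b.2.1]

theorem finite_addBox (mu : StrictPartition) : Finite {lam // AddBox lam mu} := by
  refine ((SP (∑ x ∈ mu.partSet, x - 1)).finite_toSet.subset fun lam h => ?_).to_subtype
  have h' := AddBox.sum_eq h
  rw [Finset.mem_coe, mem_SP]
  omega

instance finite_growth (n : ℕ) (lam : StrictPartition) : Finite (Growth n lam) := by
  induction n generalizing lam with
  | zero =>
    refine @Finite.of_subsingleton _ ⟨fun a b => Subtype.ext (funext fun i => ?_)⟩
    rw [Fin.fin_one_eq_zero i, a.2.1, b.2.1]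
  | succ n ih =>
    have := finite_addBox lam
    exact Finite.of_equiv _ (growthSuccEquiv n lam).symm

open scoped Classical in
theorem card_growth_succ {n : ℕ} {mu : StrictPartition} (h : mu ∈ SP (n + 1)) :
    Nat.card (Growth (n + 1) mu) = ∑ lam ∈ SP n with AddBox lam mu, Nat.card (Growth n lam) := by
  have := finite_addBox mu
  have := Fintype.ofFinite {lam // AddBox lam mu}
  rw [Nat.card_congr (growthSuccEquiv n mu), Nat.card_sigma]
  refine (Finset.sum_subtype _ (fun lam => ?_) (fun lam => Nat.card (Growth n lam))).symm
  rw [Finset.mem_filter, and_iff_right_iff_imp]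
  intro hadd
  have := hadd.sum_eq
  rw [mem_SP] at h ⊢
  omega

theorem numTableaux_eq_card_growth {n : ℕ} {lam : StrictPartition} (h : lam ∈ SP n) :
    lam.numTableaux = Nat.card (Growth n lam) := by
  rw [mem_SP, ← size_eq_sum] at h
  subst h
  rfl

end StrictPartition

/-! ### Partial fraction identities -/

theorem sum_prod_sub_div_prod_sub {ι F : Type*} [DecidableEq ι] [Field F] (s : Finset ι)
    (v w : ι → F) (hv : Set.InjOn v s) :
    ∑ i ∈ s, (∏ j ∈ s, (v i - w j)) / ∏ j ∈ s.erase i, (v i - v j) =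
      ∑ i ∈ s, v i - ∑ i ∈ s, w i := by
  classical
  rcases s.eq_empty_or_nonempty with rfl | hs
  · simp
  have hdeg : (Lagrange.nodal s w - Lagrange.nodal s v).degree < s.card := by
    refine lt_of_lt_of_eq (Polynomial.degree_sub_lt_left ?_ ?_ ?_)
      (Lagrange.degree_nodal (v := w))
    · rw [Lagrange.degree_nodal, Lagrange.degree_nodal]
    · exact Lagrange.nodal_ne_zero
    · rw [Lagrange.nodal_monic.leadingCoeff, Lagrange.nodal_monic.leadingCoeff]
  have h := Lagrange.coeff_eq_sum hv hdeg
  rw [Polynomial.coeff_sub, Lagrange.nodal_eq, Lagrange.nodal_eq,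
    Polynomial.prod_X_sub_C_coeff_card_pred s w hs.card_pos,
    Polynomial.prod_X_sub_C_coeff_card_pred s v hs.card_pos] at h
  rw [show ∑ i ∈ s, v i - ∑ i ∈ s, w i = -∑ i ∈ s, w i - -∑ i ∈ s, v i by ring, h]
  refine Finset.sum_congr rfl fun i hi => ?_
  simp [Polynomial.eval_prod, Finset.prod_eq_zero hi]

theorem sum_eval_div_mul_prod_sub {ι F : Type*} [DecidableEq ι] [Field F] (s : Finset ι)
    (v : ι → F) (hv : Set.InjOn v s) (P : Polynomial F) (hP : P.degree < s.card) (u : F) :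
    ∑ i ∈ s, P.eval (v i) / (∏ j ∈ s.erase i, (v i - v j)) * ∏ j ∈ s.erase i, (u - v j) =
      P.eval u := by
  conv_rhs => rw [Lagrange.eq_interpolate hv hP, Lagrange.interpolate_apply]
  rw [Polynomial.eval_finsetSum]
  refine Finset.sum_congr rfl fun i hi => ?_
  simp only [Polynomial.eval_mul, Polynomial.eval_C, Lagrange.basis, Polynomial.eval_prod,
    Lagrange.basisDivisor, Polynomial.eval_sub, Polynomial.eval_X, Finset.prod_mul_distrib,
    Finset.prod_inv_distrib]
  ring

theorem injOn_mul_pred {S : Finset ℕ} (h0 : 0 ∉ S) :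
    Set.InjOn (fun x : ℕ => (x : ℚ) * (x - 1)) S := by
  intro x hx y hy h
  have hx0 : 0 < x := Nat.pos_of_ne_zero fun h => h0 (h ▸ hx)
  have hy0 : 0 < y := Nat.pos_of_ne_zero fun h => h0 (h ▸ hy)
  have h1 : ((x : ℚ) - y) * (x + y - 1) = 0 := by linear_combination h
  rcases mul_eq_zero.1 h1 with h2 | h2
  · exact_mod_cast sub_eq_zero.1 h2
  · have : (x : ℚ) + y = 1 := by linarith
    have : x + y = 1 := by exact_mod_cast this
    omega

theorem injective_mul_succ : Function.Injective (fun x : ℕ => (x : ℚ) * (x + 1)) := by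
  intro x y h
  have h1 : ((x : ℚ) - y) * (x + y + 1) = 0 := by linear_combination h
  rcases mul_eq_zero.1 h1 with h2 | h2
  · exact_mod_cast sub_eq_zero.1 h2
  · have : (0 : ℚ) < x + y + 1 := by positivity
    exact absurd h2 this.ne'

namespace StrictPartition

/-! ### The product formula for the number of standard tableaux -/

/-- The factor `(x - y) / (x + y)` contributed to the number of tableaux by parts `x > y`. -/
def pairFactor (x y : ℕ) : ℚ := if y < x then ((x : ℚ) - y) / (x + y) else 1

/-- The product formula
`n! / ∏ x! * ∏_{x > y} (x - y) / (x + y)` for the number of standard tableaux of the shifted shape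
whose set of parts is `S`, with `n = ∑ x`. -/
def productFormula (S : Finset ℕ) : ℚ :=
  ((∑ x ∈ S, x).factorial : ℚ) / (∏ x ∈ S, (x.factorial : ℚ)) *
    ∏ x ∈ S, ∏ y ∈ S, pairFactor x y

theorem pairFactor_pos (x y : ℕ) : 0 < pairFactor x y := by
  unfold pairFactor
  split_ifs with h
  · have : (y : ℚ) < x := by exact_mod_cast h
    exact div_pos (by linarith) (by linarith [y.cast_nonneg (α := ℚ)])
  · exact one_pos

theorem productFormula_pos (S : Finset ℕ) : 0 < productFormula S := by
  unfold productFormula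
  have h1 : 0 < ∏ x ∈ S, ∏ y ∈ S, pairFactor x y :=
    Finset.prod_pos fun x _ => Finset.prod_pos fun y _ => pairFactor_pos x y
  have h2 : 0 < ∏ x ∈ S, (x.factorial : ℚ) := Finset.prod_pos fun x _ => by positivity
  positivity

theorem productFormula_insert {a : ℕ} {T : Finset ℕ} (h : a ∉ T) :
    productFormula (insert a T) =
      ((a + ∑ x ∈ T, x).factorial : ℚ) / (a.factorial * ∏ x ∈ T, (x.factorial : ℚ)) *
        ((∏ y ∈ T, pairFactor a y * pairFactor y a) * ∏ x ∈ T, ∏ y ∈ T, pairFactor x y) := by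
  unfold productFormula
  rw [Finset.sum_insert h, Finset.prod_insert h, Finset.prod_insert h, Finset.prod_insert h]
  congr 1
  have h1 : pairFactor a a = 1 := by simp [pairFactor]
  have h2 : ∀ x ∈ T, ∏ y ∈ insert a T, pairFactor x y =
      pairFactor x a * ∏ y ∈ T, pairFactor x y := fun x _ => Finset.prod_insert h
  rw [h1, Finset.prod_congr rfl h2, Finset.prod_mul_distrib, Finset.prod_mul_distrib]
  ring

theorem productFormula_erase_zero (S : Finset ℕ) :
    productFormula (S.erase 0) = productFormula S := by
  by_cases h : 0 ∈ S
  · conv_rhs => rw [← Finset.insert_erase h, productFormula_insert (Finset.notMem_erase 0 S)]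
    have h1 : ∏ y ∈ S.erase 0, pairFactor 0 y * pairFactor y 0 = 1 := by
      refine Finset.prod_eq_one fun y hy => ?_
      have hy0 : 0 < y := Nat.pos_of_ne_zero (Finset.ne_of_mem_erase hy)
      have : (y : ℚ) ≠ 0 := by exact_mod_cast hy0.ne'
      simp [pairFactor, hy0, this]
    rw [h1]
    simp [productFormula]
  · rw [Finset.erase_eq_of_notMem h]

theorem productFormula_insert_zero (S : Finset ℕ) :
    productFormula (insert 0 S) = productFormula S := by
  rw [← productFormula_erase_zero, Finset.erase_insert_eq_erase, productFormula_erase_zero]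

/-- The effect of raising a part from `x` to `x + 1` on the factors involving a part `y`. -/
def raiseFactor (x y : ℕ) : ℚ := (((x : ℚ) + 1 - y) * (x + y)) / ((x + 1 + y) * (x - y))

theorem raiseFactor_ne_zero {x y : ℕ} (hy : y ≠ 0) (h : y ≠ x) (h' : y ≠ x + 1) :
    raiseFactor x y ≠ 0 := by
  have h1 : (x : ℚ) + 1 - y ≠ 0 := sub_ne_zero.2 (by exact_mod_cast h'.symm)
  have h2 : (x : ℚ) - y ≠ 0 := sub_ne_zero.2 (by exact_mod_cast h.symm)
  have h3 : (x : ℚ) + y ≠ 0 := by exact_mod_cast (by omega : x + y ≠ 0)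
  have h4 : (x : ℚ) + 1 + y ≠ 0 := by positivity
  unfold raiseFactor
  positivity

theorem pairFactor_succ {x y : ℕ} (hy : y ≠ 0) (h : y ≠ x) (h' : y ≠ x + 1) :
    pairFactor (x + 1) y * pairFactor y (x + 1) =
      pairFactor x y * pairFactor y x * raiseFactor x y := by
  have h2 : (x : ℚ) - y ≠ 0 := sub_ne_zero.2 (by exact_mod_cast h.symm)
  have h2' : (y : ℚ) - x ≠ 0 := sub_ne_zero.2 (by exact_mod_cast h)
  have h3 : (x : ℚ) + y ≠ 0 := by exact_mod_cast (by omega : x + y ≠ 0)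
  have h4 : (x : ℚ) + 1 + y ≠ 0 := by positivity
  unfold raiseFactor pairFactor
  rcases lt_or_gt_of_ne h with hlt | hgt
  · rw [if_pos (by omega), if_neg (by omega), if_pos hlt, if_neg (by omega)]
    push_cast
    field_simp
  · rw [if_neg (by omega), if_pos (by omega), if_neg (by omega), if_pos hgt]
    push_cast
    rw [add_comm (y : ℚ) x, add_comm (y : ℚ) (x + 1)]
    field_simp
    ring

theorem productFormula_succ {x : ℕ} {T : Finset ℕ} (h0 : 0 ∉ T) (hx : x ∉ T) (hx1 : x + 1 ∉ T) :
    productFormula (insert (x + 1) T) = productFormula (insert x T) *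
      (((x + ∑ y ∈ T, y : ℕ) + 1 : ℚ) / (x + 1) * ∏ y ∈ T, raiseFactor x y) := by
  rw [productFormula_insert hx, productFormula_insert hx1]
  have h1 : ∏ y ∈ T, pairFactor (x + 1) y * pairFactor y (x + 1) =
      (∏ y ∈ T, pairFactor x y * pairFactor y x) * ∏ y ∈ T, raiseFactor x y := by
    rw [← Finset.prod_mul_distrib]
    refine Finset.prod_congr rfl fun y hy => pairFactor_succ ?_ ?_ ?_
    · rintro rfl; exact h0 hy
    · rintro rfl; exact hx hy
    · rintro rfl; exact hx1 hy
  have h2 : ∏ y ∈ T, (y.factorial : ℚ) ≠ 0 :=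
    Finset.prod_ne_zero_iff.2 fun y _ => by positivity
  have h3 : (x.factorial : ℚ) ≠ 0 := by positivity
  rw [h1, show x + 1 + ∑ y ∈ T, y = x + ∑ y ∈ T, y + 1 by ring, Nat.factorial_succ,
    Nat.factorial_succ]
  push_cast
  field_simp

/-- The partial fraction identity behind the recursion for the number of tableaux. -/
theorem sum_mul_prod_raiseFactor_inv {S : Finset ℕ} (h0 : 0 ∉ S) :
    ∑ a ∈ S, (a : ℚ) * ∏ y ∈ S.erase a, (raiseFactor (a - 1) y)⁻¹ = ∑ a ∈ S, (a : ℚ) := by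
  have h := sum_prod_sub_div_prod_sub S (fun x : ℕ => (x : ℚ) * (x - 1))
    (fun x : ℕ => (x : ℚ) * (x + 1)) (injOn_mul_pred h0)
  rw [← Finset.sum_sub_distrib] at h
  have h2 : ∑ x ∈ S, ((x : ℚ) * (x - 1) - x * (x + 1)) = -2 * ∑ x ∈ S, (x : ℚ) := by
    rw [Finset.mul_sum]
    exact Finset.sum_congr rfl fun x _ => by ring
  rw [h2] at h
  have h3 : ∀ a ∈ S, (∏ j ∈ S, ((a : ℚ) * (a - 1) - j * (j + 1))) /
      (∏ j ∈ S.erase a, ((a : ℚ) * (a - 1) - j * (j - 1))) =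
      -2 * ((a : ℚ) * ∏ y ∈ S.erase a, (raiseFactor (a - 1) y)⁻¹) := by
    intro a ha
    have ha0 : 1 ≤ a := Nat.pos_of_ne_zero fun h => h0 (h ▸ ha)
    rw [← Finset.mul_prod_erase S _ ha, mul_div_assoc, ← Finset.prod_div_distrib, ← mul_assoc]
    congr 1
    · ring
    · refine Finset.prod_congr rfl fun y _ => ?_
      unfold raiseFactor
      rw [inv_div]
      push_cast [ha0]
      congr 1 <;> ring
  rw [Finset.sum_congr rfl h3, ← Finset.mul_sum] at h
  linarith

theorem sum_productFormula_remove {S : Finset ℕ} (h0 : 0 ∉ S) {n : ℕ}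
    (hn : ∑ x ∈ S, x = n + 1) :
    ∑ a ∈ S with a - 1 ∉ S, productFormula ((insert (a - 1) (S.erase a)).erase 0) =
      productFormula S := by
  have hn' : ∑ x ∈ S, (x : ℚ) = n + 1 := by rw [← Nat.cast_sum, hn]; push_cast; rfl
  have key : ∀ a ∈ S, (if a - 1 ∉ S then
      productFormula ((insert (a - 1) (S.erase a)).erase 0) else 0) =
      productFormula S / (n + 1) * (a * ∏ y ∈ S.erase a, (raiseFactor (a - 1) y)⁻¹) := by
    intro a ha
    obtain ⟨x, rfl⟩ : ∃ x, a = x + 1 :=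
      Nat.exists_eq_succ_of_ne_zero fun h => h0 (h ▸ ha)
    rw [Nat.add_sub_cancel]
    by_cases h : x ∈ S
    -- If `x` is a part as well, the right side contains the factor for `y = x`, which is the
    -- inverse of `raiseFactor x x = 0` (a division by `x - x`).
    · rw [if_neg (not_not.2 h)]
      rw [Finset.prod_eq_zero (i := x)]
      · simp
      · simp [h]
      · simp [raiseFactor]
    · rw [if_pos h]
      have h0' : 0 ∉ S.erase (x + 1) := by simp [h0]
      have hx' : x ∉ S.erase (x + 1) := by simp [h]
      have hsum : x + ∑ y ∈ S.erase (x + 1), y = n := by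
        have := Finset.add_sum_erase S (fun y => y) ha
        omega
      have hs := productFormula_succ h0' hx' (Finset.notMem_erase _ _)
      rw [Finset.insert_erase ha, hsum] at hs
      have hR : ∏ y ∈ S.erase (x + 1), raiseFactor x y ≠ 0 := by
        refine Finset.prod_ne_zero_iff.2 fun y hy => raiseFactor_ne_zero ?_ ?_ ?_
        · rintro rfl; exact h0' hy
        · rintro rfl; exact hx' hy
        · exact Finset.ne_of_mem_erase hy
      have h1 : (n : ℚ) + 1 ≠ 0 := by positivity
      have h2 : (x : ℚ) + 1 ≠ 0 := by positivity
      rw [productFormula_erase_zero, hs, Finset.prod_inv_distrib]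
      push_cast
      field_simp
  rw [Finset.sum_filter, Finset.sum_congr rfl key, ← Finset.mul_sum,
    sum_mul_prod_raiseFactor_inv h0, hn']
  have h1 : (n : ℚ) + 1 ≠ 0 := by positivity
  field_simp

theorem card_growth_eq_productFormula (n : ℕ) (lam : StrictPartition) (h : lam ∈ SP n) :
    (Nat.card (Growth n lam) : ℚ) = productFormula lam.partSet := by
  classical
  induction n generalizing lam with
  | zero =>
    have h0 : lam.partSet = ∅ := by
      rw [mem_SP, Finset.sum_eq_zero_iff] at h
      exact Finset.eq_empty_of_forall_notMem fun x hx => lam.zero_notMem_partSet (h x hx ▸ hx)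
    rw [card_growth_zero h, h0]
    simp [productFormula]
  | succ n ih =>
    rw [card_growth_succ h, Nat.cast_sum,
      Finset.sum_congr rfl fun lam' h' => ih lam' (Finset.mem_filter.1 h').1,
      sum_addBox_right lam h, sum_productFormula_remove lam.zero_notMem_partSet (mem_SP.1 h)]

theorem numTableaux_eq_productFormula (lam : StrictPartition) :
    (lam.numTableaux : ℚ) = productFormula lam.partSet := by
  have h : lam ∈ SP (∑ x ∈ lam.partSet, x) := mem_SP.2 rfl
  rw [numTableaux_eq_card_growth h, card_growth_eq_productFormula _ _ h]

end StrictPartition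

namespace StrictPartition

/-! ### Transition probabilities and their moments -/

/-- The probability `2^{1+ℓ(lam)-ℓ(mu)} g^mu / ((n+1) g^lam)` of adding a box to a part `x` in the
growth process of the shifted Plancherel measures; `S` is the set of parts of `lam`, and `x = 0`
stands for the creation of a new part. It vanishes if `x + 1 ∈ S`. -/
def transProb (S : Finset ℕ) (x : ℕ) : ℚ :=
  (if x = 0 then 1 else 2) / ((x : ℚ) + 1) * ∏ y ∈ S.erase x, raiseFactor x y

theorem transProb_eq_zero {S : Finset ℕ} {x : ℕ} (h : x + 1 ∈ S) : transProb S x = 0 := by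
  unfold transProb
  rw [Finset.prod_eq_zero (i := x + 1), mul_zero]
  · simp [h]
  · simp [raiseFactor]

theorem transProb_eq_div {S : Finset ℕ} (h0 : 0 ∉ S) {x : ℕ} (hx : x ∈ insert 0 S) :
    transProb S x = (∏ y ∈ S, ((x : ℚ) * (x + 1) - y * (y - 1))) /
      ∏ y ∈ (insert 0 S).erase x, ((x : ℚ) * (x + 1) - y * (y + 1)) := by
  have hR : ∀ y : ℕ, raiseFactor x y =
      ((x : ℚ) * (x + 1) - y * (y - 1)) / ((x : ℚ) * (x + 1) - y * (y + 1)) := by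
    intro y; unfold raiseFactor; congr 1 <;> ring
  unfold transProb
  rw [Finset.prod_congr rfl fun y _ => hR y, Finset.prod_div_distrib]
  by_cases hx0 : x = 0
  · subst hx0
    rw [Finset.erase_insert h0, Finset.erase_eq_of_notMem h0]
    simp
  · have hxS : x ∈ S := (Finset.mem_insert.1 hx).resolve_left hx0
    have hx' : (x : ℚ) ≠ 0 := by exact_mod_cast hx0
    have hx1 : (x : ℚ) + 1 ≠ 0 := by positivity
    rw [Finset.erase_insert_of_ne (Ne.symm hx0), Finset.prod_insert (by simp [h0]),
      ← Finset.mul_prod_erase S _ hxS, if_neg hx0, div_mul_div_comm, mul_comm ((x : ℚ) + 1),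
      ← mul_div_mul_left _ _ hx']
    congr 1 <;> push_cast <;> ring

open PowerSeries in
/-- The geometric series `1 / (1 - z X)`. -/
noncomputable def geomSeries (z : ℚ) : ℚ⟦X⟧ := PowerSeries.mk fun n => z ^ n

open PowerSeries in
theorem geomSeries_mul (z : ℚ) : geomSeries z * (1 - C z * X) = 1 := by
  ext n
  rw [mul_sub, mul_one, mul_left_comm, map_sub, coeff_C_mul, coeff_one]
  cases n with
  | zero => simp [geomSeries]
  | succ n => simp [geomSeries, coeff_succ_mul_X, pow_succ']

open PowerSeries in
/-- The series `∏ (1 - x (x - 1) X) / (1 - x (x + 1) X)`, whose coefficients are the moments of the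
transition probabilities. -/
noncomputable def momentSeries (S : Finset ℕ) : ℚ⟦X⟧ :=
  ∏ x ∈ S, ((1 - C ((x : ℚ) * (x - 1)) * X) * geomSeries ((x : ℚ) * (x + 1)))

theorem sum_transProb_mul_prod {S : Finset ℕ} (h0 : 0 ∉ S) (u : ℚ) :
    ∑ x ∈ insert 0 S, transProb S x * ∏ y ∈ (insert 0 S).erase x, (u - y * (y + 1)) =
      ∏ y ∈ S, (u - y * (y - 1)) := by
  have hdeg : (Lagrange.nodal S fun y : ℕ => (y : ℚ) * (y - 1)).degree < (insert 0 S).card := by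
    rw [Lagrange.degree_nodal, Finset.card_insert_of_notMem h0]
    exact_mod_cast Nat.lt_succ_self _
  have h := sum_eval_div_mul_prod_sub (insert 0 S) (fun x : ℕ => (x : ℚ) * (x + 1))
    injective_mul_succ.injOn _ hdeg u
  simp only [Lagrange.eval_nodal] at h
  rw [← h]
  exact Finset.sum_congr rfl fun x hx => by rw [transProb_eq_div h0 hx]

open Polynomial in
theorem sum_transProb_mul_prod_one_sub {S : Finset ℕ} (h0 : 0 ∉ S) :
    ∑ x ∈ insert 0 S, C (transProb S x) *
        ∏ y ∈ (insert 0 S).erase x, (1 - C ((y : ℚ) * (y + 1)) * X) =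
      ∏ y ∈ S, (1 - C ((y : ℚ) * (y - 1)) * X) := by
  -- At `w ≠ 0` this is the preceding identity at `u = w⁻¹`, multiplied by `w ^ S.card`.
  refine Polynomial.eq_of_infinite_eval_eq _ _
    ((Set.finite_singleton (0 : ℚ)).infinite_compl.mono ?_)
  intro w hw
  have hw0 : w ≠ 0 := hw
  have hscale : ∀ (T : Finset ℕ) (f : ℕ → ℚ),
      ∏ y ∈ T, (1 - f y * w) = w ^ T.card * ∏ y ∈ T, (w⁻¹ - f y) := by
    intro T f
    rw [← Finset.prod_const, ← Finset.prod_mul_distrib]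
    exact Finset.prod_congr rfl fun y _ => by field_simp
  simp only [Set.mem_ofPred_eq, eval_finsetSum, eval_mul, eval_C, eval_prod, eval_sub, eval_one,
    eval_X]
  rw [hscale S fun y => (y : ℚ) * (y - 1), ← sum_transProb_mul_prod h0, Finset.mul_sum]
  refine Finset.sum_congr rfl fun x hx => ?_
  rw [hscale _ fun y => (y : ℚ) * (y + 1), Finset.card_erase_of_mem hx,
    Finset.card_insert_of_notMem h0, Nat.add_sub_cancel]
  ring

open PowerSeries in
theorem sum_transProb_mul_geomSeries {S : Finset ℕ} (h0 : 0 ∉ S) :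
    ∑ x ∈ insert 0 S, C (transProb S x) * geomSeries ((x : ℚ) * (x + 1)) = momentSeries S := by
  have hpoly := congrArg (Polynomial.coeToPowerSeries.ringHom (R := ℚ))
    (sum_transProb_mul_prod_one_sub h0)
  have hprod : ∀ (T : Finset ℕ) (f : ℕ → ℚ), Polynomial.coeToPowerSeries.ringHom
      (∏ y ∈ T, (1 - Polynomial.C (f y) * Polynomial.X)) = ∏ y ∈ T, (1 - C (f y) * X) := by
    intro T f; simp
  rw [hprod S fun y => (y : ℚ) * (y - 1), map_sum] at hpoly
  simp only [map_mul (Polynomial.coeToPowerSeries.ringHom (R := ℚ)),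
    hprod _ fun y => (y : ℚ) * (y + 1),
    Polynomial.coeToPowerSeries.ringHom_apply (φ := Polynomial.C _), Polynomial.coe_C] at hpoly
  have hG : ∏ y ∈ insert 0 S, geomSeries ((y : ℚ) * (y + 1)) =
      ∏ y ∈ S, geomSeries ((y : ℚ) * (y + 1)) := by
    have h1 : geomSeries 0 = 1 := by simpa using geomSeries_mul 0
    rw [Finset.prod_insert h0]
    simp [h1]
  have h := congrArg (· * ∏ y ∈ insert 0 S, geomSeries ((y : ℚ) * (y + 1))) hpoly
  conv_rhs at h => rw [hG, ← Finset.prod_mul_distrib]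
  rw [momentSeries, ← h, Finset.sum_mul]
  refine Finset.sum_congr rfl fun x hx => ?_
  rw [← Finset.mul_prod_erase _ _ hx, mul_assoc, mul_left_comm (∏ y ∈ _, _),
    ← Finset.prod_mul_distrib, Finset.prod_eq_one fun y _ => by rw [mul_comm, geomSeries_mul],
    mul_one]

theorem sum_transProb_mul_pow {S : Finset ℕ} (h0 : 0 ∉ S) (k : ℕ) :
    ∑ x ∈ insert 0 S, transProb S x * ((x : ℚ) * (x + 1)) ^ k =
      PowerSeries.coeff k (momentSeries S) := by
  rw [← sum_transProb_mul_geomSeries h0, map_sum]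
  simp [geomSeries]

open PowerSeries in
theorem derivative_geomSeries (z : ℚ) :
    derivative ℚ (geomSeries z) = C z * geomSeries z * geomSeries z := by
  have h := congrArg (derivative ℚ) (geomSeries_mul z)
  rw [Derivation.leibniz] at h
  simp only [smul_eq_mul, map_sub, Derivation.map_one_eq_zero, Derivation.leibniz, derivative_X,
    derivative_C, mul_zero, mul_one, add_zero, zero_sub] at h
  linear_combination geomSeries z * h - derivative ℚ (geomSeries z) * geomSeries_mul z

open PowerSeries in
theorem derivative_momentSeries (S : Finset ℕ) :
    derivative ℚ (momentSeries S) = momentSeries S * ∑ x ∈ S,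
      (C ((x : ℚ) * (x + 1)) * geomSeries ((x : ℚ) * (x + 1)) -
        C ((x : ℚ) * (x - 1)) * geomSeries ((x : ℚ) * (x - 1))) := by
  unfold momentSeries
  induction S using Finset.induction_on with
  | empty => simp
  | insert a S ha ih =>
    rw [Finset.prod_insert ha, Finset.sum_insert ha, Derivation.leibniz, ih, Derivation.leibniz,
      derivative_geomSeries]
    simp only [smul_eq_mul, map_sub, Derivation.map_one_eq_zero, Derivation.leibniz, derivative_X,
      derivative_C, mul_zero, mul_one, add_zero, zero_sub]
    have h := geomSeries_mul ((a : ℚ) * (a - 1))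
    linear_combination (geomSeries ((a : ℚ) * (a + 1)) * C ((a : ℚ) * (a - 1)) *
      ∏ x ∈ S, ((1 - C ((x : ℚ) * (x - 1)) * X) * geomSeries ((x : ℚ) * (x + 1)))) * h

/-- Newton's identities for the moments of the transition probabilities. -/
theorem succ_mul_coeff_momentSeries (S : Finset ℕ) (k : ℕ) :
    ((k : ℚ) + 1) * PowerSeries.coeff (k + 1) (momentSeries S) =
      ∑ p ∈ Finset.HasAntidiagonal.antidiagonal k, PowerSeries.coeff p.1 (momentSeries S) *
        ∑ x ∈ S, (((x : ℚ) * (x + 1)) ^ (p.2 + 1) - ((x : ℚ) * (x - 1)) ^ (p.2 + 1)) := by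
  have h := congrArg (PowerSeries.coeff k) (derivative_momentSeries S)
  rw [PowerSeries.coeff_derivative, PowerSeries.coeff_mul] at h
  rw [mul_comm, h]
  refine Finset.sum_congr rfl fun p _ => ?_
  rw [map_sum]
  congr 1
  refine Finset.sum_congr rfl fun x _ => ?_
  rw [map_sub, PowerSeries.coeff_C_mul, PowerSeries.coeff_C_mul]
  simp [geomSeries, pow_succ']

theorem coeff_zero_momentSeries (S : Finset ℕ) : PowerSeries.coeff 0 (momentSeries S) = 1 := by
  rw [PowerSeries.coeff_zero_eq_constantCoeff_apply, momentSeries, map_prod]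
  refine Finset.prod_eq_one fun x _ => ?_
  rw [map_mul, ← PowerSeries.coeff_zero_eq_constantCoeff_apply (geomSeries _)]
  simp [geomSeries]

/-! ### The growth process -/

theorem two_zpow_mul_productFormula {S : Finset ℕ} (h0 : 0 ∉ S) {n : ℕ} (hn : ∑ y ∈ S, y = n)
    {x : ℕ} (hx : x ∈ insert 0 S) (hx1 : x + 1 ∉ S) :
    (2 : ℚ) ^ ((n : ℤ) + 1 - ((insert (x + 1) (S.erase x)).card : ℤ)) *
        productFormula (insert (x + 1) (S.erase x)) =
      2 ^ ((n : ℤ) - (S.card : ℤ)) * productFormula S * ((n + 1) * transProb S x) := by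
  have h2 : (2 : ℚ) ≠ 0 := two_ne_zero
  have hcard : (insert (x + 1) (S.erase x)).card = (S.erase x).card + 1 :=
    Finset.card_insert_of_notMem (by simp [hx1])
  rw [productFormula_succ (by simp [h0]) (Finset.notMem_erase _ _) (by simp [hx1]), hcard,
    transProb]
  by_cases hx0 : x = 0
  · subst hx0
    rw [productFormula_insert_zero, Finset.erase_eq_of_notMem h0, hn, if_pos rfl]
    have : (n : ℤ) + 1 - ((S.card + 1 : ℕ) : ℤ) = n - S.card := by push_cast; ring
    rw [this]
    push_cast
    ring
  · have hxS : x ∈ S := (Finset.mem_insert.1 hx).resolve_left hx0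
    have hsum : x + ∑ y ∈ S.erase x, y = n := by
      rw [← hn]; exact Finset.add_sum_erase S (fun y => y) hxS
    have : (n : ℤ) + 1 - (((S.erase x).card + 1 : ℕ) : ℤ) = n - S.card + 1 := by
      rw [Finset.card_erase_add_one hxS]; ring
    rw [Finset.insert_erase hxS, hsum, this, zpow_add_one₀ h2, if_neg hx0]
    ring

/-- The shifted Plancherel measures form a growth process with transition probabilities
`transProb`. -/
theorem average_succ (n : ℕ) (F : Finset ℕ → ℚ) :
    shiftedPlancherelAverage (n + 1) (fun lam => F lam.partSet) =
      shiftedPlancherelAverage n fun lam => ∑ x ∈ insert 0 lam.partSet,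
        transProb lam.partSet x * F (insert (x + 1) (lam.partSet.erase x)) := by
  classical
  let w : ℕ → Finset ℕ → ℚ := fun n S => (2 : ℚ) ^ ((n : ℤ) - (S.card : ℤ)) * productFormula S
  have hP : ∀ (n : ℕ) (lam : StrictPartition), shiftedPlancherel n lam =
      w n lam.partSet * productFormula lam.partSet / n.factorial := by
    intro n lam
    rw [shiftedPlancherel, numTableaux_eq_productFormula, length_eq_card]
    ring
  have hrec : ∀ mu ∈ SP (n + 1), productFormula mu.partSet =
      ∑ lam ∈ SP n with AddBox lam mu, productFormula lam.partSet := fun mu hmu => by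
    rw [sum_addBox_right mu hmu, sum_productFormula_remove mu.zero_notMem_partSet (mem_SP.1 hmu)]
  have hfac : (n.factorial : ℚ) ≠ 0 := by positivity
  have hn1 : (n : ℚ) + 1 ≠ 0 := by positivity
  calc shiftedPlancherelAverage (n + 1) (fun lam => F lam.partSet)
      = ∑ mu ∈ SP (n + 1), ∑ lam ∈ SP n with AddBox lam mu,
          w (n + 1) mu.partSet * F mu.partSet * (productFormula lam.partSet /
            (n + 1).factorial) := by
        refine Finset.sum_congr rfl fun mu hmu => ?_
        rw [hP, ← Finset.mul_sum, ← Finset.sum_div, ← hrec mu hmu]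
        ring
    _ = ∑ lam ∈ SP n, (∑ mu ∈ SP (n + 1) with AddBox lam mu,
          w (n + 1) mu.partSet * F mu.partSet) *
            (productFormula lam.partSet / (n + 1).factorial) := by
        simp only [Finset.sum_mul]
        refine Finset.sum_comm' fun mu lam => ?_
        simp only [Finset.mem_filter]
        tauto
    _ = _ := by
        refine Finset.sum_congr rfl fun lam hlam => ?_
        have h0 := lam.zero_notMem_partSet
        rw [sum_addBox_left lam hlam fun S => w (n + 1) S * F S, hP, Finset.mul_sum,
          Finset.sum_filter, Finset.sum_mul]
        refine Finset.sum_congr rfl fun x hx => ?_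
        by_cases hx1 : x + 1 ∈ lam.partSet
        · rw [transProb_eq_zero hx1, if_neg (not_not.2 hx1)]
          simp
        · have h := two_zpow_mul_productFormula h0 (mem_SP.1 hlam) hx hx1
          simp only [w, if_pos hx1]
          push_cast
          rw [h, Nat.factorial_succ]
          push_cast
          field_simp

end StrictPartition

namespace StrictPartition

/-! ### The degree filtration -/

/-- Functions of the set of parts that are polynomials in the odd power sums, filtered by the
degree in which `p_{2m+1}` has degree `m + 1`: `SuperDegLE d f` says that `f` has degree at most
`d`. -/
inductive SuperDegLE : ℕ → (Finset ℕ → ℚ) → Prop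
  | const (c : ℚ) : SuperDegLE 0 fun _ => c
  | oddPowerSum (m : ℕ) : SuperDegLE (m + 1) fun S => ∑ x ∈ S, (x : ℚ) ^ (2 * m + 1)
  | mono {d e : ℕ} {f : Finset ℕ → ℚ} : SuperDegLE d f → d ≤ e → SuperDegLE e f
  | add {d : ℕ} {f g : Finset ℕ → ℚ} :
      SuperDegLE d f → SuperDegLE d g → SuperDegLE d fun S => f S + g S
  | mul {d e : ℕ} {f g : Finset ℕ → ℚ} :
      SuperDegLE d f → SuperDegLE e g → SuperDegLE (d + e) fun S => f S * g S

namespace SuperDegLE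

theorem const_mul {d : ℕ} {f : Finset ℕ → ℚ} (c : ℚ) (hf : SuperDegLE d f) :
    SuperDegLE d fun S => c * f S := by
  simpa using (const c).mul hf

theorem sum {ι : Type*} {d : ℕ} (s : Finset ι) {f : ι → Finset ℕ → ℚ}
    (hf : ∀ i ∈ s, SuperDegLE d (f i)) : SuperDegLE d fun S => ∑ i ∈ s, f i S := by
  classical
  induction s using Finset.induction_on with
  | empty => simpa using (const 0).mono (Nat.zero_le d)
  | insert a s ha ih =>
    simp only [Finset.sum_insert ha]
    exact (hf a (Finset.mem_insert_self a s)).add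
      (ih fun i hi => hf i (Finset.mem_insert_of_mem hi))

/-- With `b_r = (x (x + 1))^r - (x (x - 1))^r`, the proof uses the recursion
`b_{r+2} = 2 x² b_{r+1} - (x⁴ - x²) b_r`. -/
theorem sum_pow_mul_sub (r j : ℕ) : SuperDegLE (r + j) fun S => ∑ x ∈ S,
    (x : ℚ) ^ (2 * j) * (((x : ℚ) * (x + 1)) ^ r - ((x : ℚ) * (x - 1)) ^ r) := by
  induction r using Nat.twoStepInduction generalizing j with
  | zero => simpa using (const 0).mono (Nat.zero_le _)
  | one =>
    have h := ((oddPowerSum j).const_mul 2).mono (Nat.add_comm j 1).le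
    convert h using 2 with S
    rw [Finset.mul_sum]
    exact Finset.sum_congr rfl fun x _ => by ring
  | more r ih0 ih1 =>
    have h1 := ((ih1 (j + 1)).const_mul 2).mono (show r + 1 + (j + 1) ≤ r + 2 + j by omega)
    have h2 := ((ih0 (j + 2)).const_mul (-1)).mono (show r + (j + 2) ≤ r + 2 + j by omega)
    have h3 := (ih0 (j + 1)).mono (show r + (j + 1) ≤ r + 2 + j by omega)
    convert (h1.add h2).add h3 using 2 with S
    rw [Finset.mul_sum, Finset.mul_sum, ← Finset.sum_add_distrib, ← Finset.sum_add_distrib]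
    exact Finset.sum_congr rfl fun x _ => by ring

theorem coeff_momentSeries (k : ℕ) :
    SuperDegLE k fun S => PowerSeries.coeff k (momentSeries S) := by
  induction k using Nat.strong_induction_on with
  | h k ih =>
    rcases k with _ | k
    · simpa only [coeff_zero_momentSeries] using const 1
    · have h : SuperDegLE (k + 1) fun S => ((k : ℚ) + 1)⁻¹ *
          ∑ p ∈ Finset.HasAntidiagonal.antidiagonal k, PowerSeries.coeff p.1 (momentSeries S) *
            ∑ x ∈ S, (((x : ℚ) * (x + 1)) ^ (p.2 + 1) - ((x : ℚ) * (x - 1)) ^ (p.2 + 1)) := by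
        refine (sum _ fun p hp => ?_).const_mul _
        have hp' : p.1 + p.2 = k := Finset.HasAntidiagonal.mem_antidiagonal.1 hp
        have h2 := sum_pow_mul_sub (p.2 + 1) 0
        simp only [mul_zero, pow_zero, one_mul, add_zero] at h2
        exact ((ih p.1 (by omega)).mul h2).mono (by omega)
      convert h using 2 with S
      rw [← succ_mul_coeff_momentSeries]
      have : (k : ℚ) + 1 ≠ 0 := by positivity
      field_simp

end SuperDegLE

/-- Polynomials in `z` whose coefficients are functions as in `SuperDegLE`, where `z` has degree
`1`: `IncrDegLT e G` says that the total degree of `G` is less than `e`. The variable `z` stands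
for the value `x (x + 1)` at a part `x` that is raised to `x + 1`. -/
inductive IncrDegLT : ℕ → (Finset ℕ → ℚ → ℚ) → Prop
  | zero (e : ℕ) : IncrDegLT e fun _ _ => 0
  | monomial {d k e : ℕ} {f : Finset ℕ → ℚ} :
      SuperDegLE d f → d + k < e → IncrDegLT e fun S z => f S * z ^ k
  | add {e : ℕ} {G H : Finset ℕ → ℚ → ℚ} :
      IncrDegLT e G → IncrDegLT e H → IncrDegLT e fun S z => G S z + H S z

namespace IncrDegLT

theorem mono {d e : ℕ} {G : Finset ℕ → ℚ → ℚ} (hG : IncrDegLT d G) (h : d ≤ e) :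
    IncrDegLT e G := by
  induction hG with
  | zero => exact zero e
  | monomial hf hlt => exact monomial hf (hlt.trans_le h)
  | add _ _ ih1 ih2 => exact (ih1 h).add (ih2 h)

/-- Multiplication by a function of degree at most `d` times `z ^ k`. -/
theorem monomial_mul {d k e : ℕ} {f : Finset ℕ → ℚ} {G : Finset ℕ → ℚ → ℚ}
    (hf : SuperDegLE d f) (hG : IncrDegLT e G) :
    IncrDegLT (d + k + e) fun S z => f S * z ^ k * G S z := by
  induction hG with
  | zero => simpa using zero _
  | @monomial d' k' e g hg hlt =>
    convert monomial (k := k + k') (hf.mul hg) (show d + d' + (k + k') < d + k + e by omega)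
      using 3
    ring
  | add _ _ ih1 ih2 => simpa only [mul_add] using ih1.add ih2

theorem super_mul {d e : ℕ} {f : Finset ℕ → ℚ} {G : Finset ℕ → ℚ → ℚ}
    (hf : SuperDegLE d f) (hG : IncrDegLT e G) :
    IncrDegLT (d + e) fun S z => f S * G S z := by
  simpa using monomial_mul (k := 0) hf hG

theorem mul {d e : ℕ} {G H : Finset ℕ → ℚ → ℚ} (hG : IncrDegLT d G) (hH : IncrDegLT e H) :
    IncrDegLT (d + e) fun S z => G S z * H S z := by
  induction hG with
  | zero => simpa using zero _
  | monomial hf hlt => exact (monomial_mul hf hH).mono (by omega)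
  | add _ _ ih1 ih2 => simpa only [add_mul] using ih1.add ih2

theorem eq_zero {G : Finset ℕ → ℚ → ℚ} (hG : IncrDegLT 0 G) (S : Finset ℕ) (z : ℚ) :
    G S z = 0 := by
  generalize he : 0 = e at hG
  induction hG with
  | zero => rfl
  | monomial _ hlt => omega
  | add _ _ ih1 ih2 => simp only [ih1 he, ih2 he, add_zero]

/-- Averaging over the transition probabilities replaces the power `z ^ k` by the `k`-th moment,
which has degree at most `k`. -/
theorem exists_average {e d : ℕ} {G : Finset ℕ → ℚ → ℚ} (hG : IncrDegLT e G) (h : e ≤ d + 1) :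
    ∃ f, SuperDegLE d f ∧ ∀ S : Finset ℕ, 0 ∉ S →
      ∑ x ∈ insert 0 S, transProb S x * G S ((x : ℚ) * (x + 1)) = f S := by
  induction hG with
  | zero => exact ⟨fun _ => 0, (SuperDegLE.const 0).mono (Nat.zero_le _), by simp⟩
  | @monomial d' k e f hf hlt =>
    refine ⟨fun S => f S * PowerSeries.coeff k (momentSeries S),
      (hf.mul (SuperDegLE.coeff_momentSeries k)).mono (by omega), fun S h0 => ?_⟩
    dsimp only
    rw [← sum_transProb_mul_pow h0, Finset.mul_sum]
    exact Finset.sum_congr rfl fun x _ => by ring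
  | add _ _ ih1 ih2 =>
    obtain ⟨f, hf, hf'⟩ := ih1 h
    obtain ⟨g, hg, hg'⟩ := ih2 h
    refine ⟨_, hf.add hg, fun S h0 => ?_⟩
    rw [← hf' S h0, ← hg' S h0, ← Finset.sum_add_distrib]
    exact Finset.sum_congr rfl fun x _ => by ring

/-- `(x + 1)^{2m+1} - x^{2m+1}` is a polynomial of degree `m` in `z = x (x + 1)`, since
`(x + 1)²` and `x²` have sum `2 z + 1` and product `z²`. -/
theorem exists_succ_pow_sub_pow (m : ℕ) : ∃ G, IncrDegLT (m + 1) G ∧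
    ∀ (S : Finset ℕ) (x : ℚ), G S (x * (x + 1)) = (x + 1) ^ (2 * m + 1) - x ^ (2 * m + 1) := by
  induction m using Nat.twoStepInduction with
  | zero =>
    exact ⟨_, monomial (k := 0) (SuperDegLE.const 1) (by omega), fun S x => by ring⟩
  | one =>
    exact ⟨_, (monomial (k := 1) (SuperDegLE.const 3) (by omega)).add
      (monomial (k := 0) (SuperDegLE.const 1) (by omega)), fun S x => by ring⟩
  | more m ih0 ih1 =>
    obtain ⟨G0, h0, hG0⟩ := ih0
    obtain ⟨G1, h1, hG1⟩ := ih1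
    refine ⟨_, (((monomial_mul (k := 1) (SuperDegLE.const 2) h1).mono (by omega)).add
      (h1.mono (by omega))).add
      ((monomial_mul (k := 2) (SuperDegLE.const (-1)) h0).mono (by omega)), fun S x => ?_⟩
    rw [hG0, hG1]
    ring

end IncrDegLT

/-- Adding a box changes a function of degree at most `d` by a polynomial in `z = x (x + 1)` of
total degree less than `d`. -/
theorem SuperDegLE.exists_increment {d : ℕ} {f : Finset ℕ → ℚ} (hf : SuperDegLE d f) :
    ∃ G, IncrDegLT d G ∧ ∀ (S : Finset ℕ) (x : ℕ), x ∈ insert 0 S → x + 1 ∉ S →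
      f (insert (x + 1) (S.erase x)) = f S + G S ((x : ℚ) * (x + 1)) := by
  induction hf with
  | const c => exact ⟨_, IncrDegLT.zero 0, by simp⟩
  | oddPowerSum m =>
    obtain ⟨G, hG, h⟩ := IncrDegLT.exists_succ_pow_sub_pow m
    refine ⟨G, hG, fun S x hx hx1 => ?_⟩
    have hsum : ∑ y ∈ S.erase x, (y : ℚ) ^ (2 * m + 1) =
        ∑ y ∈ S, (y : ℚ) ^ (2 * m + 1) - (x : ℚ) ^ (2 * m + 1) := by
      by_cases hxS : x ∈ S
      · rw [← Finset.add_sum_erase S _ hxS]; ring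
      · obtain rfl : x = 0 := (Finset.mem_insert.1 hx).resolve_right hxS
        rw [Finset.erase_eq_of_notMem hxS]; simp
    dsimp only
    rw [h, Finset.sum_insert (by simp [hx1]), hsum]
    push_cast
    ring
  | mono _ hle ih =>
    obtain ⟨G, hG, h⟩ := ih
    exact ⟨G, hG.mono hle, h⟩
  | add _ _ ih1 ih2 =>
    obtain ⟨G, hG, hG'⟩ := ih1
    obtain ⟨H, hH, hH'⟩ := ih2
    refine ⟨_, hG.add hH, fun S x hx hx1 => ?_⟩
    dsimp only
    rw [hG' S x hx hx1, hH' S x hx hx1]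
    ring
  | @mul d e f g hf hg ih1 ih2 =>
    obtain ⟨G, hG, hG'⟩ := ih1
    obtain ⟨H, hH, hH'⟩ := ih2
    refine ⟨_, ((IncrDegLT.super_mul hf hH).add
      ((IncrDegLT.super_mul hg hG).mono (Nat.add_comm e d).le)).add (hG.mul hH),
      fun S x hx hx1 => ?_⟩
    dsimp only
    rw [hG' S x hx hx1, hH' S x hx hx1]
    ring

/-! ### Polynomiality -/

theorem exists_polynomial_sum_range (Q : Polynomial ℚ) :
    ∃ P : Polynomial ℚ, ∀ n : ℕ, ∑ i ∈ Finset.range n, Q.eval (i : ℚ) = P.eval (n : ℚ) := by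
  induction Q using Polynomial.induction_on' with
  | add p q hp hq =>
    obtain ⟨P, hP⟩ := hp
    obtain ⟨P', hP'⟩ := hq
    exact ⟨P + P', fun n => by simp [Finset.sum_add_distrib, hP, hP']⟩
  | monomial p c =>
    refine ⟨Polynomial.C c * ∑ i ∈ Finset.range (p + 1),
      Polynomial.C (bernoulli i * ((p + 1).choose i) / (p + 1)) * Polynomial.X ^ (p + 1 - i),
      fun n => ?_⟩
    simp only [Polynomial.eval_monomial, ← Finset.mul_sum, sum_range_pow, Polynomial.eval_mul,
      Polynomial.eval_C, Polynomial.eval_finsetSum, Polynomial.eval_pow, Polynomial.eval_X]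
    congr 1
    exact Finset.sum_congr rfl fun i _ => by ring

theorem exists_polynomial_of_sub_eq {a : ℕ → ℚ} {Q : Polynomial ℚ}
    (h : ∀ n : ℕ, a (n + 1) - a n = Q.eval (n : ℚ)) :
    ∃ P : Polynomial ℚ, ∀ n : ℕ, a n = P.eval (n : ℚ) := by
  obtain ⟨P, hP⟩ := exists_polynomial_sum_range Q
  refine ⟨P + Polynomial.C (a 0), fun n => ?_⟩
  rw [Polynomial.eval_add, Polynomial.eval_C, ← hP, ← Finset.sum_congr rfl fun i _ => h i,
    Finset.sum_range_sub, sub_add_cancel]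

theorem average_succ_sub {f : Finset ℕ → ℚ} {G : Finset ℕ → ℚ → ℚ}
    (hG : ∀ (S : Finset ℕ) (x : ℕ), x ∈ insert 0 S → x + 1 ∉ S →
      f (insert (x + 1) (S.erase x)) = f S + G S ((x : ℚ) * (x + 1))) (n : ℕ) :
    shiftedPlancherelAverage (n + 1) (fun lam => f lam.partSet) -
      shiftedPlancherelAverage n (fun lam => f lam.partSet) =
    shiftedPlancherelAverage n fun lam => ∑ x ∈ insert 0 lam.partSet,
      transProb lam.partSet x * G lam.partSet ((x : ℚ) * (x + 1)) := by
  rw [average_succ, shiftedPlancherelAverage, shiftedPlancherelAverage, shiftedPlancherelAverage,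
    ← Finset.sum_sub_distrib]
  refine Finset.sum_congr rfl fun lam _ => ?_
  rw [← mul_sub]
  congr 1
  have h1 : ∑ x ∈ insert 0 lam.partSet, transProb lam.partSet x = 1 := by
    simpa [coeff_zero_momentSeries] using sum_transProb_mul_pow lam.zero_notMem_partSet 0
  have h2 : f lam.partSet = ∑ x ∈ insert 0 lam.partSet,
      transProb lam.partSet x * f lam.partSet := by
    rw [← Finset.sum_mul, h1, one_mul]
  conv_lhs => rw [h2]
  rw [← Finset.sum_sub_distrib]
  refine Finset.sum_congr rfl fun x hx => ?_
  by_cases hx1 : x + 1 ∈ lam.partSet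
  · simp [transProb_eq_zero hx1]
  · rw [hG _ x hx hx1]; ring

theorem SuperDegLE.exists_polynomial {d : ℕ} {f : Finset ℕ → ℚ} (hf : SuperDegLE d f) :
    ∃ P : Polynomial ℚ, ∀ n : ℕ,
      shiftedPlancherelAverage n (fun lam => f lam.partSet) = P.eval (n : ℚ) := by
  induction d generalizing f with
  | zero =>
    obtain ⟨G, hG, h⟩ := hf.exists_increment
    refine exists_polynomial_of_sub_eq (Q := 0) fun n => ?_
    rw [average_succ_sub h]
    simp [hG.eq_zero, shiftedPlancherelAverage]
  | succ d ih =>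
    obtain ⟨G, hG, h⟩ := hf.exists_increment
    obtain ⟨g, hg, hg'⟩ := hG.exists_average le_rfl
    obtain ⟨Q, hQ⟩ := ih hg
    refine exists_polynomial_of_sub_eq (Q := Q) fun n => ?_
    rw [average_succ_sub h, ← hQ]
    simp only [hg' _ (zero_notMem_partSet _)]

end StrictPartition

/-! ### Supersymmetric functions as functions of the set of parts -/

theorem symmetricValue_oddPowerSum (m : ℕ) (lam : StrictPartition) :
    symmetricValue (oddPowerSum m) lam = ∑ x ∈ lam.partSet, (x : ℚ) ^ (2 * m + 1) := by
  have h := List.sum_toFinset (fun x : ℕ => (x : ℚ) ^ (2 * m + 1)) lam.nodup_parts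
  rw [StrictPartition.partSet, h, ← Fin.sum_univ_fun_getElem]
  simp only [symmetricValue, oddPowerSum, MvPolynomial.psum, map_sum, map_pow,
    MvPolynomial.eval_X]
  refine Finset.sum_congr rfl fun i _ => ?_
  rw [StrictPartition.part, Nat.add_sub_cancel, List.getD_eq_getElem _ _ i.2]
  rfl

theorem exists_superDegLE (f : SymmetricFunctions) (hf : f ∈ SupersymmetricFunctions) :
    ∃ d F, StrictPartition.SuperDegLE d F ∧ ∀ lam, symmetricValue f lam = F lam.partSet := by
  induction hf using Algebra.adjoin_induction with
  | mem f hf =>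
    obtain ⟨m, rfl⟩ := hf
    exact ⟨_, _, .oddPowerSum m, symmetricValue_oddPowerSum m⟩
  | algebraMap r => exact ⟨_, _, .const r, fun lam => by simp [symmetricValue]⟩
  | add f g _ _ hf hg =>
    obtain ⟨d, F, hF, hF'⟩ := hf
    obtain ⟨e, G, hG, hG'⟩ := hg
    refine ⟨_, _, (hF.mono (le_max_left d e)).add (hG.mono (le_max_right d e)), fun lam => ?_⟩
    rw [← hF', ← hG']
    simp [symmetricValue]
  | mul f g _ _ hf hg =>
    obtain ⟨d, F, hF, hF'⟩ := hf
    obtain ⟨e, G, hG, hG'⟩ := hg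
    refine ⟨_, _, hF.mul hG, fun lam => ?_⟩
    rw [← hF', ← hG']
    simp [symmetricValue]

theorem theorem1p1 (f : SymmetricFunctions) (hf : f ∈ SupersymmetricFunctions) :
    ∃ P : Polynomial ℚ, ∀ n : ℕ,
      StrictPartition.shiftedPlancherelAverage n (symmetricValue f) = P.eval (n : ℚ) := by
  obtain ⟨d, F, hF, h⟩ := exists_superDegLE f hf
  rw [show symmetricValue f = fun lam => F lam.partSet from funext h]
  exact hF.exists_polynomial
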